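/- Let $1<p<N$, let $\Omega\subset\mathbb R^N$ be a bounded domain (open and connected; no regularity of $\partial\Omega$ is needed), put $p^\star=\frac{pN}{N-p}$, and let $W_0^{1,p}(\Omega)$ (the closure of $C_c^\infty(\Omega)$ in $W^{1,p}(\Omega)$) be endowed with the norm $\|u\|=\left(\int_\Omega|\nabla u|^p\,dx\right)^{1/p}$. Let $$S=\sup_{u\in W_0^{1,p}(\Omega)\setminus\{0\}}\frac{\|u\|_{p^\star}^{p^\star}}{\|u\|^{p^\star}} .$$ Let $M:[0,+\infty)\to[0,+\infty)$ be continuous with $\hat M(t)=\int_0^tM(s)\,ds$, and suppose that $$\lim_{t\to0^+}M(t)>0\qquad\text{and}\qquad(\gamma_1)\quad \inf_{t>0}\frac{M(t)}{t^{\frac{p^\star}{p}-1}}>S .$$ Let $f:\Omega\times\mathbb R\to\mathbb R$ be a Carathéodory function with primitive $F(x,t)=\int_0^tf(x,s)\,ds$ such that - there are $c_1,c_2>0$ and $q\in(p,p^\star)$ with $|f(x,t)|\le c_1+c_2|t|^{q-1}$ for all $t\in\mathbb R$ and a.e. $x\in\Omega$; - $\lim_{t\to0}\frac{f(x,t)}{|t|^{p-1}}=0$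 uniformly in (almost every) $x\in\Omega$; - for a.e. $x\in\Omega$, $f(x,t)>0$ for every $t>0$ and $f(x,t)<0$ for every $t<0$. For $\lambda\in\mathbb R$ consider the problem $$(P)\qquad -M\left(\int_\Omega|\nabla u|^p\,dx\right)\Delta_pu=|u|^{p^\star-2}u+\lambda f(x,u)\ \text{ in }\Omega,\qquad u=0\ \text{ on }\partial\Omega,$$ whose weak solutions are the critical points in $W_0^{1,p}(\Omega)$ of the energy functional $$\Phi_\lambda(u)=\frac1p\hat M(\|u\|^p)-\frac1{p^\star}\|u\|_{p^\star}^{p^\star}-\lambda\int_\Omega F(x,u(x))\,dx .$$ Then there exists a number $\lambda_1^\star>0$ such that for all $-\infty<\lambda<\lambda_1^\star$ problem $(P)$ has only the trivial weak solution, i.e. $u=0$ is the one and only critical point of $\Phi_\lambda$. -/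

import Mathlib

open MeasureTheory Filter Topology Set
open scoped ENNReal ContDiff Gradient

noncomputable section

namespace Kirchhoff

instance factOneLeOfReal (p : ℝ) [hp : Fact (1 < p)] : Fact (1 ≤ ENNReal.ofReal p) :=
  ⟨by simpa using ENNReal.ofReal_le_ofReal hp.out.le⟩

/-- `ℝ^N` with its Euclidean norm. -/
abbrev Space (N : ℕ) : Type := EuclideanSpace ℝ (Fin N)

/-- The ambient Banach space `L^p(Ω) × L^p(Ω; ℝ^N)` of candidate pairs `(u, ∇u)`. -/
abbrev Pairs {N : ℕ} (Ω : Set (Space N)) (p : ℝ) : Type :=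
  Lp ℝ (ENNReal.ofReal p) (volume.restrict Ω) ×
    Lp (Space N) (ENNReal.ofReal p) (volume.restrict Ω)

/-- The image of `C_c^∞(Ω)` in `L^p(Ω) × L^p(Ω; ℝ^N)` under `φ ↦ (φ, ∇φ)`. -/
def testPairs {N : ℕ} (Ω : Set (Space N)) (p : ℝ) [Fact (1 < p)] :
    Submodule ℝ (Pairs Ω p) where
  carrier := {w | ∃ φ : Space N → ℝ, ContDiff ℝ ∞ φ ∧ HasCompactSupport φ ∧ tsupport φ ⊆ Ω ∧
    w.1 =ᵐ[volume.restrict Ω] φ ∧ w.2 =ᵐ[volume.restrict Ω] ∇ φ}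
  zero_mem' := by
    refine ⟨fun _ => 0, contDiff_const, HasCompactSupport.zero, by simp [tsupport], ?_, ?_⟩
    · exact Lp.coeFn_zero _ _ _
    · filter_upwards [Lp.coeFn_zero (Space N) (ENNReal.ofReal p) (volume.restrict Ω)] with x hx
      rw [gradient_fun_const]
      exact hx
  add_mem' := by
    rintro w z ⟨φ, hφ, hφc, hφs, h1, h2⟩ ⟨χ, hχ, hχc, hχs, k1, k2⟩
    refine ⟨φ + χ, hφ.add hχ, hφc.add hχc,
      (tsupport_add φ χ).trans (union_subset hφs hχs), ?_, ?_⟩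
    · exact (Lp.coeFn_add _ _).trans (h1.add k1)
    · filter_upwards [Lp.coeFn_add w.2 z.2, h2, k2] with x hx hx1 hx2
      have e : ∇ (φ + χ) x = ∇ φ x + ∇ χ x := by
        simp only [gradient]
        rw [fderiv_add (hφ.differentiable (by simp) x) (hχ.differentiable (by simp) x), map_add]
      rw [e, ← hx1, ← hx2]
      exact hx
  smul_mem' := by
    rintro c w ⟨φ, hφ, hφc, hφs, h1, h2⟩
    refine ⟨c • φ, hφ.const_smul c, hφc.smul_left (f := fun _ => c),
      (closure_mono (Function.support_const_smul_subset c φ)).trans hφs, ?_, ?_⟩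
    · exact (Lp.coeFn_smul _ _).trans (h1.const_smul c)
    · filter_upwards [Lp.coeFn_smul c w.2, h2] with x hx hx1
      have e : ∇ (c • φ) x = c • ∇ φ x := by
        simp only [gradient]
        rw [fderiv_const_smul (hφ.differentiable (by simp) x), map_smul]
      rw [e, ← hx1]
      exact hx

/-- The Sobolev space `W_0^{1,p}(Ω)`: the closure of `C_c^∞(Ω)` in `W^{1,p}(Ω)`. A function `u` is
recorded together with its weak gradient, as the pair `(u, ∇u)`, and the norm is the `W^{1,p}` norm
`max (‖u‖_p, ‖∇u‖_p)`. On a bounded `Ω` the latter is equivalent, by Poincaré's inequality, to the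
norm `‖∇u‖_p`, so both give the same Fréchet derivatives. -/
abbrev W01p {N : ℕ} (Ω : Set (Space N)) (p : ℝ) [Fact (1 < p)] : Type :=
  (testPairs Ω p).topologicalClosure

/-- The function `u : Ω → ℝ` underlying an element of `W_0^{1,p}(Ω)`. -/
def fn {N : ℕ} {Ω : Set (Space N)} {p : ℝ} [Fact (1 < p)] (u : W01p Ω p) : Space N → ℝ :=
  u.1.1

/-- The weak gradient of an element of `W_0^{1,p}(Ω)`. -/
def wgrad {N : ℕ} {Ω : Set (Space N)} {p : ℝ} [Fact (1 < p)] (u : W01p Ω p) :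
    Space N → Space N :=
  u.1.2

/-- `‖u‖ = (∫_Ω |∇u|^p dx)^{1/p}`. -/
def gradNorm {N : ℕ} {Ω : Set (Space N)} {p : ℝ} [Fact (1 < p)] (u : W01p Ω p) : ℝ :=
  (∫ x in Ω, ‖wgrad u x‖ ^ p) ^ (1 / p)

/-- The critical Sobolev exponent `p⋆ = pN/(N-p)`, for `p < N`. -/
def critExp (N : ℕ) (p : ℝ) : ℝ := p * N / (N - p)

/-- `‖u‖_{p⋆}^{p⋆} = ∫_Ω |u|^{p⋆} dx`. -/
def critInt {N : ℕ} {Ω : Set (Space N)} {p : ℝ} [Fact (1 < p)] (u : W01p Ω p) : ℝ :=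
  ∫ x in Ω, |fn u x| ^ critExp N p

/-- The embedding constant `S = sup_{u ≠ 0} ‖u‖_{p⋆}^{p⋆} / ‖u‖^{p⋆}`; for `1 < p < N` the set of
quotients is bounded by the Sobolev inequality. -/
def sobolevConst {N : ℕ} (Ω : Set (Space N)) (p : ℝ) [Fact (1 < p)] : ℝ :=
  sSup {r : ℝ | ∃ u : W01p Ω p, u ≠ 0 ∧ r = critInt u / gradNorm u ^ critExp N p}

/-- The primitive `t ↦ ∫_0^t g(s) ds`. -/
def primitive (g : ℝ → ℝ) (t : ℝ) : ℝ := ∫ s in (0 : ℝ)..t, g s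

/-- The energy functional
`Φ_λ(u) = (1/p) M̂(‖u‖^p) - (1/p⋆) ‖u‖_{p⋆}^{p⋆} - λ ∫_Ω F(x, u(x)) dx`. -/
def energy {N : ℕ} {Ω : Set (Space N)} {p : ℝ} [Fact (1 < p)] (M : ℝ → ℝ)
    (f : Space N → ℝ → ℝ) (lam : ℝ) (u : W01p Ω p) : ℝ :=
  1 / p * primitive M (gradNorm u ^ p) - 1 / critExp N p * critInt u
    - lam * ∫ x in Ω, primitive (f x) (fn u x)

/-- A weak solution of the Kirchhoff problem
`-M(∫_Ω |∇u|^p) Δ_p u = |u|^{p⋆-2} u + λ f(x,u)` in `Ω`, `u = 0` on `∂Ω`, is a critical point of the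
energy functional on `W_0^{1,p}(Ω)`. -/
def IsWeakSolution {N : ℕ} {Ω : Set (Space N)} {p : ℝ} [Fact (1 < p)] (M : ℝ → ℝ)
    (f : Space N → ℝ → ℝ) (lam : ℝ) (u : W01p Ω p) : Prop :=
  HasFDerivAt (energy M f lam) (0 : W01p Ω p →L[ℝ] ℝ) u

/-- `f : Ω × ℝ → ℝ` is a Carathéodory function. -/
def IsCaratheodory {N : ℕ} (Ω : Set (Space N)) (f : Space N → ℝ → ℝ) : Prop :=
  (∀ t, AEStronglyMeasurable (fun x => f x t) (volume.restrict Ω)) ∧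
    ∀ᵐ x ∂(volume.restrict Ω), Continuous (f x)

end Kirchhoff

end

namespace Kirchhoff

/-! Suppose `u ≠ 0` is critical. Differentiating the energy along the ray `t ↦ t • u` at `t = 1`
gives `M(‖u‖^p) ‖u‖^p - ‖u‖_{p⋆}^{p⋆} = λ ∫ f(x,u) u` (`IsWeakSolution.nehari_identity`). By the
definition of `S`, the strict gap in (γ₁) and the positive limit of `M` at `0`, the left side is at
least `ε (‖u‖^p + ‖u‖^{p⋆})` (`exists_lower_bound`, `critInt_le`). The sign and growth of `f` give
`0 ≤ ∫ f(x,u) u ≤ C (‖u‖^p + ‖u‖^{p⋆})` (`exists_growth_bound`, `exists_integral_growth_le`). Hence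
`λ ≥ ε / C`, and `ε / C` serves as the threshold.

Conversely, the energy is `O(‖u‖^p)` near `0` with `p > 1`, so `0` is critical for every `λ`
(`isWeakSolution_zero`). -/

theorem integral_rpow_norm_eq {α E : Type*} [MeasurableSpace α] [NormedAddCommGroup E]
    {μ : Measure α} {f : α → E} {r : ℝ} (hr : 0 < r) (hf : MemLp f (ENNReal.ofReal r) μ) :
    ∫ x, ‖f x‖ ^ r ∂μ = (eLpNorm f (ENNReal.ofReal r) μ).toReal ^ r := by
  have hI : 0 ≤ ∫ x, ‖f x‖ ^ r ∂μ := integral_nonneg fun x => by positivity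
  rw [hf.eLpNorm_eq_integral_rpow_norm (by simpa using hr) (by simp), ENNReal.toReal_ofReal hr.le,
    ENNReal.toReal_ofReal (by positivity), ← Real.rpow_mul hI, inv_mul_cancel₀ hr.ne',
    Real.rpow_one]

theorem norm_gradient {N : ℕ} (φ : Space N → ℝ) (x : Space N) : ‖∇ φ x‖ = ‖fderiv ℝ φ x‖ := by
  simp [gradient]

/-! ### Poincaré and Sobolev inequalities on `W_0^{1,p}(Ω)`. -/

section Sobolev

variable {N : ℕ} {p : ℝ} [hp : Fact (1 < p)] {Ω : Set (Space N)}

theorem memLp_wgrad (u : W01p Ω p) :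
    MemLp (wgrad u) (ENNReal.ofReal p) (volume.restrict Ω) := Lp.memLp u.1.2

theorem aestronglyMeasurable_fn (u : W01p Ω p) :
    AEStronglyMeasurable (fn u) (volume.restrict Ω) := Lp.aestronglyMeasurable u.1.1

theorem fn_smul_ae (t : ℝ) (u : W01p Ω p) :
    fn (t • u) =ᵐ[volume.restrict Ω] fun x => t * fn u x := Lp.coeFn_smul t u.1.1

theorem gradNorm_eq (u : W01p Ω p) : gradNorm u = ‖u.1.2‖ := by
  have h0 : 0 < p := one_pos.trans hp.out
  rw [gradNorm, integral_rpow_norm_eq h0 (memLp_wgrad u), ← Real.rpow_mul (by positivity),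
    mul_one_div_cancel h0.ne', Real.rpow_one]
  rfl

theorem gradNorm_nonneg (u : W01p Ω p) : 0 ≤ gradNorm u := by
  rw [gradNorm_eq]; positivity

theorem gradNorm_le_norm (u : W01p Ω p) : gradNorm u ≤ ‖u‖ := by
  rw [gradNorm_eq]; exact norm_snd_le u.1

theorem gradNorm_smul (t : ℝ) (u : W01p Ω p) : gradNorm (t • u) = |t| * gradNorm u := by
  simp only [gradNorm_eq, ← Real.norm_eq_abs]
  exact norm_smul t u.1.2

theorem critInt_smul (t : ℝ) (u : W01p Ω p) :
    critInt (t • u) = |t| ^ critExp N p * critInt u := by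
  rw [critInt, critInt, ← integral_const_mul]
  refine integral_congr_ae ?_
  filter_upwards [fn_smul_ae t u] with x hx
  rw [hx, abs_mul, Real.mul_rpow (abs_nonneg _) (abs_nonneg _)]

/-- Gagliardo–Nirenberg–Sobolev for functions supported in a bounded set. The condition on `q`
covers both `q = p` (Poincaré) and `q = p⋆`. -/
theorem exists_eLpNorm_test_le (hpN : p < N) (hΩb : Bornology.IsBounded Ω) {q : ℝ} (hq : 0 < q)
    (hpq : p⁻¹ - (N : ℝ)⁻¹ ≤ q⁻¹) :
    ∃ C : ℝ≥0∞, C ≠ ⊤ ∧ ∀ w ∈ testPairs Ω p,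
      eLpNorm w.1 (ENNReal.ofReal q) (volume.restrict Ω) ≤
        C * eLpNorm w.2 (ENNReal.ofReal p) (volume.restrict Ω) := by
  have h0 : 0 < p := one_pos.trans hp.out
  refine ⟨eLpNormLESNormFDerivOfLeConst ℝ (volume : Measure (Space N)) Ω p.toNNReal q.toNNReal,
    ENNReal.coe_ne_top, ?_⟩
  rintro w ⟨φ, hφ, -, hφs, h1, h2⟩
  have hs : φ.support ⊆ Ω := (subset_tsupport φ).trans hφs
  have hs' : (∇ φ).support ⊆ Ω := by
    refine subset_trans (fun x hx => ?_) ((support_fderiv_subset ℝ (f := φ)).trans hφs)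
    rw [Function.mem_support, ← norm_ne_zero_iff, norm_gradient, norm_ne_zero_iff] at hx
    exact hx
  rw [eLpNorm_congr_ae h1, eLpNorm_congr_ae h2, eLpNorm_restrict_eq_of_support_subset hs,
    eLpNorm_restrict_eq_of_support_subset hs',
    eLpNorm_congr_norm_ae (g := fderiv ℝ φ) (ae_of_all _ (norm_gradient φ))]
  refine eLpNorm_le_eLpNorm_fderiv_of_le volume (hφ.of_le (by simp)) hs ?_ ?_ ?_ hΩb
  · simpa using hp.out.le
  · rw [finrank_euclideanSpace_fin, ← NNReal.coe_lt_coe, Real.coe_toNNReal _ h0.le]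
    simpa using hpN
  · rw [finrank_euclideanSpace_fin, Real.coe_toNNReal _ hq.le]
    simpa [Real.coe_toNNReal _ h0.le] using hpq

/-- Approximating test functions converge a.e. along a subsequence, so Fatou carries the bound to
the closure. Membership of `u` in `L^q` need not be known beforehand; it follows from the bound. -/
theorem exists_eLpNorm_fn_le (hpN : p < N) (hΩb : Bornology.IsBounded Ω) {q : ℝ} (hq : 0 < q)
    (hpq : p⁻¹ - (N : ℝ)⁻¹ ≤ q⁻¹) :
    ∃ C : ℝ≥0∞, C ≠ ⊤ ∧ ∀ u : W01p Ω p,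
      eLpNorm (fn u) (ENNReal.ofReal q) (volume.restrict Ω) ≤
        C * eLpNorm (wgrad u) (ENNReal.ofReal p) (volume.restrict Ω) := by
  obtain ⟨C, hC, H⟩ := exists_eLpNorm_test_le hpN hΩb hq hpq
  refine ⟨C, hC, fun u => ?_⟩
  have hu : u.1 ∈ closure (testPairs Ω p : Set (Pairs Ω p)) := u.2
  obtain ⟨w, hw, hlim⟩ := mem_closure_iff_seq_limit.1 hu
  have hl1 : Tendsto (fun n => (w n).1) atTop (𝓝 u.1.1) := (continuous_fst.tendsto _).comp hlim
  have hl2 : Tendsto (fun n => (w n).2) atTop (𝓝 u.1.2) := (continuous_snd.tendsto _).comp hlim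
  obtain ⟨k, hk, hae⟩ := (tendstoInMeasure_of_tendsto_Lp hl1).exists_seq_tendsto_ae
  have hl3 : Tendsto (fun n => C * eLpNorm (w (k n)).2 (ENNReal.ofReal p) (volume.restrict Ω))
      atTop (𝓝 (C * eLpNorm (wgrad u) (ENNReal.ofReal p) (volume.restrict Ω))) := by
    refine ENNReal.Tendsto.const_mul ?_ (Or.inr hC)
    have := (hl2.comp hk.tendsto_atTop).enorm
    simp only [Lp.enorm_def, Function.comp_def] at this
    exact this
  calc eLpNorm (fn u) (ENNReal.ofReal q) (volume.restrict Ω)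
      ≤ liminf (fun n => eLpNorm (w (k n)).1 (ENNReal.ofReal q) (volume.restrict Ω)) atTop :=
        Lp.eLpNorm_lim_le_liminf_eLpNorm (fun n => Lp.aestronglyMeasurable _) _ hae
    _ ≤ liminf (fun n => C * eLpNorm (w (k n)).2 (ENNReal.ofReal p) (volume.restrict Ω)) atTop :=
        liminf_le_liminf (Eventually.of_forall fun n => H _ (hw _))
    _ = _ := hl3.liminf_eq

theorem exists_integral_rpow_fn_le (hpN : p < N) (hΩb : Bornology.IsBounded Ω) {q : ℝ}
    (hq : 0 < q) (hpq : p⁻¹ - (N : ℝ)⁻¹ ≤ q⁻¹) :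
    ∃ C > 0, ∀ u : W01p Ω p, Integrable (fun x => |fn u x| ^ q) (volume.restrict Ω) ∧
      ∫ x in Ω, |fn u x| ^ q ≤ C * gradNorm u ^ q := by
  obtain ⟨C, hC, H⟩ := exists_eLpNorm_fn_le hpN hΩb hq hpq
  refine ⟨C.toReal ^ q + 1, by positivity, fun u => ?_⟩
  have hR : C * eLpNorm (wgrad u) (ENNReal.ofReal p) (volume.restrict Ω) ≠ ⊤ :=
    ENNReal.mul_ne_top hC (memLp_wgrad u).2.ne
  have hm : MemLp (fn u) (ENNReal.ofReal q) (volume.restrict Ω) :=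
    ⟨aestronglyMeasurable_fn u, (H u).trans_lt hR.lt_top⟩
  constructor
  · have := hm.integrable_norm_rpow (by simpa using hq) (by simp)
    simpa only [ENNReal.toReal_ofReal hq.le, Real.norm_eq_abs] using this
  · have h1 := integral_rpow_norm_eq hq hm
    simp only [Real.norm_eq_abs] at h1
    have h2 := ENNReal.toReal_mono hR (H u)
    have h3 : gradNorm u = (eLpNorm (wgrad u) (ENNReal.ofReal p) (volume.restrict Ω)).toReal :=
      gradNorm_eq u
    rw [ENNReal.toReal_mul, ← h3] at h2
    have hg := gradNorm_nonneg u
    rw [h1]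
    calc _ ≤ (C.toReal * gradNorm u) ^ q := by gcongr
      _ = C.toReal ^ q * gradNorm u ^ q := Real.mul_rpow (by positivity) hg
      _ ≤ _ := by gcongr; linarith

theorem gradNorm_pos (hpN : p < N) (hΩb : Bornology.IsBounded Ω) {u : W01p Ω p} (hu : u ≠ 0) :
    0 < gradNorm u := by
  have h0 : 0 < p := one_pos.trans hp.out
  refine (gradNorm_nonneg u).lt_of_ne' fun h => hu ?_
  obtain ⟨C, -, H⟩ := exists_eLpNorm_fn_le (p := p) (Ω := Ω) hpN hΩb h0 (by simp)
  have h2 : u.1.2 = 0 := by rwa [gradNorm_eq, norm_eq_zero] at h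
  have h3 : eLpNorm (wgrad u) (ENNReal.ofReal p) (volume.restrict Ω) = 0 := by
    rw [wgrad, ← Lp.enorm_def, h2, enorm_zero]
  have h4 := H u
  rw [h3, mul_zero, nonpos_iff_eq_zero, fn, ← Lp.enorm_def, enorm_eq_zero] at h4
  exact Subtype.ext (Prod.ext h4 h2)

theorem lt_critExp (hpN : p < N) : p < critExp N p := by
  have h0 : 0 < p := one_pos.trans hp.out
  rw [critExp, lt_div_iff₀ (by linarith)]
  nlinarith

theorem inv_critExp (hpN : p < N) : (critExp N p)⁻¹ = p⁻¹ - (N : ℝ)⁻¹ := by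
  have h0 : 0 < p := one_pos.trans hp.out
  have hN : (0 : ℝ) < N := h0.trans hpN
  rw [critExp, inv_div]
  field_simp

theorem critInt_le (hpN : p < N) (hΩb : Bornology.IsBounded Ω) (u : W01p Ω p) :
    critInt u ≤ sobolevConst Ω p * gradNorm u ^ critExp N p := by
  have h0 : 0 < p := one_pos.trans hp.out
  have hq : 0 < critExp N p := h0.trans (lt_critExp hpN)
  obtain ⟨C, -, H⟩ := exists_integral_rpow_fn_le (p := p) (Ω := Ω) hpN hΩb hq
    (inv_critExp hpN).ge
  rcases eq_or_ne u 0 with rfl | hu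
  · have h := (H 0).2
    have hg : gradNorm (0 : W01p Ω p) = 0 := by rw [gradNorm_eq]; exact norm_zero
    rw [hg, Real.zero_rpow hq.ne', mul_zero] at h ⊢
    exact h
  · have hg := gradNorm_pos hpN hΩb hu
    rw [← div_le_iff₀ (by positivity)]
    -- `sSup` is meaningful only for a bounded set; the Sobolev constant `C` bounds the quotients.
    refine le_csSup ⟨C, ?_⟩ ⟨u, hu, rfl⟩
    rintro _ ⟨v, hv, rfl⟩
    have hg := gradNorm_pos hpN hΩb hv
    rw [div_le_iff₀ (by positivity)]
    exact (H v).2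

theorem critInt_nonneg (u : W01p Ω p) : 0 ≤ critInt u := integral_nonneg fun x => by positivity

theorem sobolevConst_nonneg : 0 ≤ sobolevConst Ω p := by
  refine Real.sSup_nonneg ?_
  rintro _ ⟨u, -, rfl⟩
  exact div_nonneg (critInt_nonneg u) (Real.rpow_nonneg (gradNorm_nonneg u) _)

end Sobolev

/-! ### Superposition operators of Carathéodory functions. -/

section Superposition

variable {α : Type*} [MeasurableSpace α] {μ : Measure α} {f : α → ℝ → ℝ}

/-- Measurable representatives at the countably many rational `t` share one exceptional null set, on
which the function is set to `0`. Continuity then yields measurability at real `t` as a limit of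
rational ones. -/
theorem exists_measurable_caratheodory (hm : ∀ t, AEStronglyMeasurable (fun x => f x t) μ)
    (hc : ∀ᵐ x ∂μ, Continuous (f x)) :
    ∃ g : α → ℝ → ℝ, (∀ x, Continuous (g x)) ∧ (∀ t, Measurable fun x => g x t) ∧
      ∀ᵐ x ∂μ, g x = f x := by
  classical
  have hall : ∀ᵐ x ∂μ, Continuous (f x) ∧ ∀ q : ℚ, f x q = (hm q).mk _ x :=
    hc.and (ae_all_iff.2 fun q => (hm q).ae_eq_mk)
  obtain ⟨s, hs, hsm, hs0⟩ := exists_measurable_superset_of_null (ae_iff.1 hall)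
  have hout : ∀ x ∉ s, Continuous (f x) ∧ ∀ q : ℚ, f x q = (hm q).mk _ x := fun x hx => by
    by_contra h
    exact hx (hs h)
  have hgc : ∀ x, Continuous (fun t => if x ∈ s then 0 else f x t) := fun x => by
    by_cases hx : x ∈ s
    · simpa [hx] using continuous_const
    · simpa [hx] using (hout x hx).1
  refine ⟨fun x t => if x ∈ s then 0 else f x t, hgc, fun t => ?_, ?_⟩
  · have hq : ∀ q : ℚ, Measurable fun x => if x ∈ s then 0 else f x q := fun q => by
      have : (fun x => if x ∈ s then 0 else f x q) =
          fun x => if x ∈ s then 0 else (hm q).mk _ x := by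
        funext x
        split_ifs with hx
        · rfl
        · exact (hout x hx).2 q
      rw [this]
      exact Measurable.ite hsm measurable_const (hm q).stronglyMeasurable_mk.measurable
    have ht : t ∈ closure (range ((↑) : ℚ → ℝ)) := Rat.denseRange_cast t
    obtain ⟨a, ha, hlim⟩ := mem_closure_iff_seq_limit.1 ht
    choose b hb using ha
    refine measurable_of_tendsto_metrizable (f := fun n x => if x ∈ s then 0 else f x (b n))
      (fun n => hq (b n)) (tendsto_pi_nhds.2 fun x => ?_)
    have := ((hgc x).tendsto t).comp hlim
    simpa only [Function.comp_def, ← hb] using this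
  · filter_upwards [measure_eq_zero_iff_ae_notMem.1 hs0] with x hx
    simp [hx]

theorem aestronglyMeasurable_superposition (hm : ∀ t, AEStronglyMeasurable (fun x => f x t) μ)
    (hc : ∀ᵐ x ∂μ, Continuous (f x)) {v : α → ℝ} (hv : AEStronglyMeasurable v μ) :
    AEStronglyMeasurable (fun x => f x (v x)) μ := by
  obtain ⟨g, hgc, hgm, hgf⟩ := exists_measurable_caratheodory hm hc
  have hu : Measurable (Function.uncurry fun t x => g x t) :=
    measurable_uncurry_of_continuous_of_measurable hgc hgm
  refine (hu.comp_aemeasurable (hv.aemeasurable.prodMk aemeasurable_id)).aestronglyMeasurable.congr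
    ?_
  filter_upwards [hgf] with x hx
  simp [Function.uncurry, hx]

theorem aestronglyMeasurable_primitive (hm : ∀ t, AEStronglyMeasurable (fun x => f x t) μ)
    (hc : ∀ᵐ x ∂μ, Continuous (f x)) (t : ℝ) :
    AEStronglyMeasurable (fun x => primitive (f x) t) μ := by
  obtain ⟨g, hgc, hgm, hgf⟩ := exists_measurable_caratheodory hm hc
  have hu : Measurable (Function.uncurry fun t x => g x t) :=
    measurable_uncurry_of_continuous_of_measurable hgc hgm
  have hu' : StronglyMeasurable (Function.uncurry g) := (hu.comp measurable_swap).stronglyMeasurable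
  have h : StronglyMeasurable fun x => primitive (g x) t :=
    (hu'.integral_prod_right (ν := volume.restrict (Ioc 0 t))).sub
      (hu'.integral_prod_right (ν := volume.restrict (Ioc t 0)))
  refine h.aestronglyMeasurable.congr ?_
  filter_upwards [hgf] with x hx
  rw [hx]

theorem hasDerivAt_primitive {g : ℝ → ℝ} (hg : Continuous g) (t : ℝ) :
    HasDerivAt (primitive g) (g t) t :=
  hg.integral_hasStrictDerivAt 0 t |>.hasDerivAt

theorem aestronglyMeasurable_primitive_superposition
    (hm : ∀ t, AEStronglyMeasurable (fun x => f x t) μ)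
    (hc : ∀ᵐ x ∂μ, Continuous (f x)) {v : α → ℝ} (hv : AEStronglyMeasurable v μ) :
    AEStronglyMeasurable (fun x => primitive (f x) (v x)) μ := by
  refine aestronglyMeasurable_superposition (f := fun x => primitive (f x))
    (aestronglyMeasurable_primitive hm hc) ?_ hv
  filter_upwards [hc] with x hx
  exact continuous_iff_continuousAt.2 fun t => (hasDerivAt_primitive hx t).continuousAt

theorem abs_rpow_sub_one_mul {a : ℝ} (ha : a ≠ 0) (t : ℝ) : |t| ^ (a - 1) * |t| = |t| ^ a := by
  rcases eq_or_ne t 0 with rfl | ht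
  · simp [Real.zero_rpow ha]
  · rw [Real.rpow_sub_one (abs_ne_zero.2 ht), div_mul_cancel₀ _ (abs_ne_zero.2 ht)]

variable {K a b : ℝ}

theorem abs_primitive_le {g : ℝ → ℝ} (hK : 0 ≤ K) (ha : 1 < a) (hb : 1 < b)
    (hg : ∀ t, |g t| ≤ K * (|t| ^ (a - 1) + |t| ^ (b - 1))) (t : ℝ) :
    |primitive g t| ≤ K * (|t| ^ a + |t| ^ b) := by
  have h : ∀ s ∈ uIoc 0 t, ‖g s‖ ≤ K * (|t| ^ (a - 1) + |t| ^ (b - 1)) := fun s hs => by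
    have hst : |s| ≤ |t| := by
      rcases mem_uIoc.1 hs with h | h
      · rw [abs_of_pos h.1, abs_of_pos (h.1.trans_le h.2)]; exact h.2
      · rw [abs_of_nonpos h.2, abs_of_nonpos (h.1.le.trans h.2)]; linarith [h.1]
    refine (hg s).trans ?_
    have := Real.rpow_le_rpow (abs_nonneg s) hst (sub_nonneg.2 ha.le)
    have := Real.rpow_le_rpow (abs_nonneg s) hst (sub_nonneg.2 hb.le)
    gcongr
  have := intervalIntegral.norm_integral_le_of_norm_le_const h
  rw [sub_zero, mul_assoc, add_mul, abs_rpow_sub_one_mul (by linarith),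
    abs_rpow_sub_one_mul (by linarith)] at this
  exact this

/-- The derivative of `t ↦ ∫ F(x, t v(x)) dμ(x)` at `t = 1`. -/
theorem hasDerivAt_integral_primitive_mul (hm : ∀ t, AEStronglyMeasurable (fun x => f x t) μ)
    (hc : ∀ᵐ x ∂μ, Continuous (f x)) (hK : 0 ≤ K) (ha : 1 < a) (hb : 1 < b)
    (hg : ∀ᵐ x ∂μ, ∀ t, |f x t| ≤ K * (|t| ^ (a - 1) + |t| ^ (b - 1)))
    {v : α → ℝ} (hv : AEStronglyMeasurable v μ) (hva : Integrable (fun x => |v x| ^ a) μ)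
    (hvb : Integrable (fun x => |v x| ^ b) μ) :
    HasDerivAt (fun t => ∫ x, primitive (f x) (t * v x) ∂μ) (∫ x, f x (v x) * v x ∂μ) 1 := by
  -- For `t ∈ (0, 2)` one has `|t v| ≤ 2 |v|`, whence the powers of `2` in the dominating function.
  have hbd : Integrable (fun x => K * (2 ^ (a - 1) * |v x| ^ a + 2 ^ (b - 1) * |v x| ^ b)) μ :=
    ((hva.const_mul _).add (hvb.const_mul _)).const_mul K
  have key := hasDerivAt_integral_of_dominated_loc_of_deriv_le (μ := μ) (x₀ := (1 : ℝ))
    (F := fun t x => primitive (f x) (t * v x)) (F' := fun t x => f x (t * v x) * v x)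
    (s := Ioo 0 2) (bound := fun x => K * (2 ^ (a - 1) * |v x| ^ a + 2 ^ (b - 1) * |v x| ^ b))
    (Ioo_mem_nhds one_pos one_lt_two)
    (Eventually.of_forall fun t =>
      aestronglyMeasurable_primitive_superposition hm hc (hv.const_mul t))
    ?_ ((aestronglyMeasurable_superposition hm hc (hv.const_mul 1)).mul hv) ?_ hbd ?_
  · simpa using key.2
  · refine Integrable.mono' ((hva.add hvb).const_mul K)
      (aestronglyMeasurable_primitive_superposition hm hc (hv.const_mul 1)) ?_
    filter_upwards [hg] with x hx
    simpa using abs_primitive_le hK ha hb hx (v x)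
  · filter_upwards [hg] with x hx t ht
    rw [norm_mul, Real.norm_eq_abs, Real.norm_eq_abs]
    have h0 : |t * v x| ≤ 2 * |v x| := by
      rw [abs_mul, abs_of_pos ht.1]
      exact mul_le_mul_of_nonneg_right ht.2.le (abs_nonneg _)
    have h1 := Real.rpow_le_rpow (abs_nonneg _) h0 (sub_nonneg.2 ha.le)
    have h2 := Real.rpow_le_rpow (abs_nonneg _) h0 (sub_nonneg.2 hb.le)
    rw [Real.mul_rpow zero_le_two (abs_nonneg _)] at h1 h2
    calc |f x (t * v x)| * |v x|
        ≤ K * (2 ^ (a - 1) * |v x| ^ (a - 1) + 2 ^ (b - 1) * |v x| ^ (b - 1)) * |v x| := by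
          gcongr
          exact (hx _).trans (by gcongr)
      _ = K * (2 ^ (a - 1) * (|v x| ^ (a - 1) * |v x|)
            + 2 ^ (b - 1) * (|v x| ^ (b - 1) * |v x|)) := by ring
      _ = _ := by
          rw [abs_rpow_sub_one_mul (by linarith), abs_rpow_sub_one_mul (by linarith)]
  · filter_upwards [hc] with x hx t _
    exact (hasDerivAt_primitive hx (t * v x)).comp t (by simpa using (hasDerivAt_id t).mul_const (v x))

/-- Near `0` the smallness condition with `ε = 1` gives `|t|^(p-1)`. For `|t| ≥ δ` the constant `c₁`
is absorbed into `|t|^(p-1)` at the cost of `δ^(p-1)`, and `|t|^(q-1)` lies below the sum of the two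
outer powers. At `t = 0` itself only `f x 0 = 0` helps. -/
theorem exists_growth_bound {p r : ℝ} (hp : 1 < p)
    (hf1 : ∃ c₁ > 0, ∃ c₂ > 0, ∃ q, p < q ∧ q < r ∧
      ∀ᵐ x ∂μ, ∀ t, |f x t| ≤ c₁ + c₂ * |t| ^ (q - 1))
    (hf2 : ∀ ε > 0, ∃ δ > 0, ∀ᵐ x ∂μ, ∀ t, 0 < |t| → |t| < δ →
      |f x t / |t| ^ (p - 1)| ≤ ε)
    (hf0 : ∀ᵐ x ∂μ, f x 0 = 0) :
    ∃ K > 0, ∀ᵐ x ∂μ, ∀ t, |f x t| ≤ K * (|t| ^ (p - 1) + |t| ^ (r - 1)) := by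
  obtain ⟨c₁, hc₁, c₂, hc₂, q, hpq, hqr, hgr⟩ := hf1
  obtain ⟨δ, hδ, hsm⟩ := hf2 1 one_pos
  have hδp : 0 < δ ^ (p - 1) := by positivity
  refine ⟨1 + c₁ / δ ^ (p - 1) + c₂, by positivity, ?_⟩
  filter_upwards [hgr, hsm, hf0] with x h1 h2 h3 t
  rcases eq_or_ne t 0 with rfl | ht
  · rw [h3, abs_zero]; positivity
  have ht' : 0 < |t| := abs_pos.2 ht
  have hA : 0 < |t| ^ (p - 1) := by positivity
  have hB : 0 < |t| ^ (r - 1) := by positivity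
  have hD : 0 < c₁ / δ ^ (p - 1) := by positivity
  rcases lt_or_ge |t| δ with htδ | htδ
  · have h := h2 t ht' htδ
    rw [abs_div, abs_of_pos hA, div_le_one hA] at h
    nlinarith [mul_pos hD hA, mul_pos hD hB, mul_pos hc₂ hA, mul_pos hc₂ hB]
  · have h4 : |t| ^ (q - 1) ≤ |t| ^ (p - 1) + |t| ^ (r - 1) := by
      rcases le_total |t| 1 with h | h
      · have := Real.rpow_le_rpow_of_exponent_ge ht' h (show p - 1 ≤ q - 1 by linarith)
        linarith
      · have := Real.rpow_le_rpow_of_exponent_le h (show q - 1 ≤ r - 1 by linarith)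
        linarith
    have h5 : c₁ ≤ c₁ / δ ^ (p - 1) * |t| ^ (p - 1) := by
      rw [div_mul_eq_mul_div, le_div_iff₀ hδp]
      gcongr
    nlinarith [h1 t, mul_le_mul_of_nonneg_left h4 hc₂.le, mul_pos hD hB]

end Superposition

theorem eq_zero_of_sign {g : ℝ → ℝ} (hg : Continuous g) (hpos : ∀ t, 0 < t → 0 < g t)
    (hneg : ∀ t, t < 0 → g t < 0) : g 0 = 0 := by
  refine le_antisymm ?_ ?_
  · refine le_of_tendsto (hg.continuousWithinAt (s := Iio 0)) ?_
    filter_upwards [self_mem_nhdsWithin] with t ht using (hneg t ht).le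
  · refine ge_of_tendsto (hg.continuousWithinAt (s := Ioi 0)) ?_
    filter_upwards [self_mem_nhdsWithin] with t ht using (hpos t ht).le

/-! ### The Kirchhoff term and the critical points of the energy. -/

section Energy

theorem hasDerivAt_primitive_of_continuousOn {M : ℝ → ℝ} (hMc : ContinuousOn M (Ici 0)) {T : ℝ}
    (hT : 0 < T) : HasDerivAt (primitive M) (M T) T := by
  refine intervalIntegral.integral_hasDerivAt_right ?_ ?_ (hMc.continuousAt (Ici_mem_nhds hT))
  · refine (hMc.mono ?_).intervalIntegrable
    rw [uIcc_of_le hT.le]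
    exact Icc_subset_Ici_self
  · exact (hMc.mono Ioi_subset_Ici_self).stronglyMeasurableAtFilter isOpen_Ioi T hT

theorem exists_abs_primitive_le_of_continuousOn {M : ℝ → ℝ} (hMc : ContinuousOn M (Ici 0)) :
    ∃ B > 0, ∀ s, 0 ≤ s → s ≤ 1 → |primitive M s| ≤ B * s := by
  obtain ⟨B, hB⟩ := isCompact_Icc.exists_bound_of_continuousOn
    (hMc.mono (Icc_subset_Ici_self : Icc (0 : ℝ) 1 ⊆ Ici 0))
  refine ⟨|B| + 1, by positivity, fun s hs hs1 => ?_⟩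
  have h := intervalIntegral.norm_integral_le_of_norm_le_const (a := 0) (b := s) (f := M)
    (C := |B| + 1) fun x hx => by
      rw [uIoc_of_le hs] at hx
      have := hB x ⟨hx.1.le, hx.2.trans hs1⟩
      linarith [le_abs_self B]
  rwa [sub_zero, abs_of_nonneg hs] at h

/-- Two lower bounds are averaged: a positive constant and a multiple of `t ^ r`. The infimum gap
gives the second for all `t`, and also the first away from `0`; near `0` the constant comes from the
limit `m`. -/
theorem exists_lower_bound {M : ℝ → ℝ} {r S : ℝ} (hr : 0 < r) (hM0 : ∀ t, 0 ≤ t → 0 ≤ M t)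
    (hM1 : ∃ m > 0, Tendsto M (𝓝[>] 0) (𝓝 m))
    (hM2 : S < ⨅ t : Ioi (0 : ℝ), M t / (t : ℝ) ^ r) :
    ∃ ε > 0, ∀ t, 0 < t → ε * (1 + t ^ r) ≤ M t - S * t ^ r := by
  obtain ⟨m, hm, hlim⟩ := hM1
  set I := ⨅ t : Ioi (0 : ℝ), M t / (t : ℝ) ^ r with hI
  have hIM : ∀ t, 0 < t → I * t ^ r ≤ M t := fun t ht => by
    rw [← le_div_iff₀ (by positivity)]
    refine ciInf_le (f := fun t : Ioi (0 : ℝ) => M t / (t : ℝ) ^ r) ⟨0, ?_⟩ ⟨t, ht⟩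
    rintro _ ⟨s, rfl⟩
    exact div_nonneg (hM0 _ (le_of_lt s.2)) (Real.rpow_nonneg (le_of_lt s.2) _)
  have hpow : Tendsto (fun t : ℝ => M t - S * t ^ r) (𝓝[>] 0) (𝓝 m) := by
    have h0 : Tendsto (fun t : ℝ => t ^ r) (𝓝[>] 0) (𝓝 0) := by
      have := (Real.continuousAt_rpow_const 0 r (Or.inr hr.le)).tendsto
      rw [Real.zero_rpow hr.ne'] at this
      exact this.mono_left nhdsWithin_le_nhds
    simpa using hlim.sub (h0.const_mul S)
  obtain ⟨t₀, ht₀, hnear⟩ := mem_nhdsGT_iff_exists_Ioo_subset.1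
    (hpow.eventually_const_lt (half_lt_self hm))
  have ht₀ : 0 < t₀ := ht₀
  have hd : 0 < I - S := sub_pos.2 hM2
  have ht₀r : 0 < t₀ ^ r := by positivity
  -- The division by `2` pays for adding the constant bound and the power bound.
  refine ⟨min (min (m / 2) ((I - S) * t₀ ^ r)) (I - S) / 2, by positivity, fun t ht => ?_⟩
  have htr : 0 < t ^ r := by positivity
  have h1 : (I - S) * t ^ r ≤ M t - S * t ^ r := by linarith [hIM t ht]
  have h2 : min (m / 2) ((I - S) * t₀ ^ r) ≤ M t - S * t ^ r := by
    rcases lt_or_ge t t₀ with h | h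
    · exact (min_le_left _ _).trans (hnear ⟨ht, h⟩).le
    · refine (min_le_right _ _).trans (le_trans ?_ h1)
      gcongr
  have h3 := (min_le_left (min (m / 2) ((I - S) * t₀ ^ r)) (I - S)).trans h2
  have h4 := (mul_le_mul_of_nonneg_right
    (min_le_right (min (m / 2) ((I - S) * t₀ ^ r)) (I - S)) htr.le).trans h1
  linarith

variable {N : ℕ} {p : ℝ} [hp : Fact (1 < p)] {Ω : Set (Space N)} {M : ℝ → ℝ}
  {f : Space N → ℝ → ℝ} {K lam : ℝ}

theorem exists_integral_growth_le (hpN : p < N) (hΩb : Bornology.IsBounded Ω) (hK : 0 < K) :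
    ∃ C > 0, ∀ u : W01p Ω p,
      Integrable (fun x => |fn u x| ^ p) (volume.restrict Ω) ∧
      Integrable (fun x => |fn u x| ^ critExp N p) (volume.restrict Ω) ∧
      ∫ x in Ω, K * (|fn u x| ^ p + |fn u x| ^ critExp N p) ≤
        C * (gradNorm u ^ p + gradNorm u ^ critExp N p) := by
  have h0 : 0 < p := one_pos.trans hp.out
  have hq : 0 < critExp N p := h0.trans (lt_critExp hpN)
  obtain ⟨C₁, hC₁, H₁⟩ := exists_integral_rpow_fn_le (p := p) (Ω := Ω) hpN hΩb h0 (by simp)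
  obtain ⟨C₂, hC₂, H₂⟩ := exists_integral_rpow_fn_le (p := p) (Ω := Ω) hpN hΩb hq
    (inv_critExp hpN).ge
  refine ⟨K * (C₁ + C₂), by positivity, fun u => ⟨(H₁ u).1, (H₂ u).1, ?_⟩⟩
  rw [integral_const_mul, integral_add (H₁ u).1 (H₂ u).1, mul_assoc]
  have hg := gradNorm_nonneg u
  have h1 : 0 ≤ C₁ * gradNorm u ^ critExp N p := by positivity
  have h2 : 0 ≤ C₂ * gradNorm u ^ p := by positivity
  gcongr
  linarith [(H₁ u).2, (H₂ u).2]

/-- Every term of the energy is bounded by a multiple of `‖u‖ ^ p` on the unit ball, which is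
`o(‖u‖)`. This avoids a chain rule at `0`, where `M` is controlled only from the right. -/
theorem isWeakSolution_zero (hpN : p < N) (hΩb : Bornology.IsBounded Ω)
    (hMc : ContinuousOn M (Ici 0)) (hK : 0 < K)
    (hg : ∀ᵐ x ∂(volume.restrict Ω), ∀ t,
      |f x t| ≤ K * (|t| ^ (p - 1) + |t| ^ (critExp N p - 1))) :
    IsWeakSolution M f lam (0 : W01p Ω p) := by
  have h0 : 0 < p := one_pos.trans hp.out
  have hpq := lt_critExp (N := N) hpN
  have hq : 0 < critExp N p := h0.trans hpq
  obtain ⟨B, hB, HB⟩ := exists_abs_primitive_le_of_continuousOn hMc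
  obtain ⟨C, hC, H⟩ := exists_integral_growth_le (p := p) (Ω := Ω) hpN hΩb hK
  have hS := sobolevConst_nonneg (Ω := Ω) (p := p)
  have hbound : ∀ u : W01p Ω p, ‖u‖ ≤ 1 → |energy M f lam u| ≤
      (1 / p * B + 1 / critExp N p * sobolevConst Ω p + |lam| * (C * 2)) * ‖u‖ ^ p := fun u hu => by
    have hgn := gradNorm_nonneg u
    have hgu := gradNorm_le_norm u
    have hgp : gradNorm u ^ p ≤ ‖u‖ ^ p := by gcongr
    have hgq : gradNorm u ^ critExp N p ≤ ‖u‖ ^ p :=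
      (Real.rpow_le_rpow_of_exponent_ge_of_imp hgn (hgu.trans hu) hpq.le
        fun _ h => absurd h hq.ne').trans hgp
    have h1 : |primitive M (gradNorm u ^ p)| ≤ B * ‖u‖ ^ p :=
      (HB _ (by positivity) (Real.rpow_le_one hgn (hgu.trans hu) h0.le)).trans (by gcongr)
    have h2 : |critInt u| ≤ sobolevConst Ω p * ‖u‖ ^ p := by
      rw [abs_of_nonneg (critInt_nonneg u)]
      exact (critInt_le hpN hΩb u).trans (by gcongr)
    have h3 : |∫ x in Ω, primitive (f x) (fn u x)| ≤ C * 2 * ‖u‖ ^ p := by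
      rw [← Real.norm_eq_abs]
      refine (norm_integral_le_of_norm_le (((H u).1.add (H u).2.1).const_mul K) ?_).trans
        ((H u).2.2.trans ?_)
      · filter_upwards [hg] with x hx
        exact abs_primitive_le hK.le hp.out (hp.out.trans hpq) hx _
      · rw [mul_assoc]
        gcongr
        linarith
    rw [energy]
    refine (abs_sub _ _).trans ((add_le_add (abs_sub _ _) le_rfl).trans ?_)
    rw [abs_mul, abs_mul, abs_mul, abs_of_pos (one_div_pos.2 h0), abs_of_pos (one_div_pos.2 hq),
      add_mul, add_mul, mul_assoc, mul_assoc, mul_assoc |lam|]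
    gcongr
  -- The bound at `u = 0` already forces the value `0`.
  have hzero : energy M f lam (0 : W01p Ω p) = 0 := by
    have := hbound 0 (by simp)
    rw [norm_zero, Real.zero_rpow h0.ne', mul_zero] at this
    exact abs_nonpos_iff.1 this
  have hO : (fun u : W01p Ω p => energy M f lam u) =O[𝓝 0] fun u => ‖u‖ ^ p := by
    refine Asymptotics.IsBigO.of_bound
      (1 / p * B + 1 / critExp N p * sobolevConst Ω p + |lam| * (C * 2)) ?_
    filter_upwards [Metric.closedBall_mem_nhds (0 : W01p Ω p) one_pos] with u hu
    rw [Real.norm_of_nonneg (Real.rpow_nonneg (norm_nonneg u) p)]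
    exact hbound u (by simpa using hu)
  have ho : (fun u : W01p Ω p => ‖u‖ ^ p) =o[𝓝 0] fun u => u := by
    have h1 : Tendsto (fun u : W01p Ω p => ‖u‖ ^ (p - 1)) (𝓝 0) (𝓝 0) := by
      have := (continuous_norm (E := W01p Ω p)).rpow_const (p := p - 1)
        (fun _ => Or.inr (sub_nonneg.2 hp.out.le)) |>.tendsto 0
      rwa [norm_zero, Real.zero_rpow (sub_pos.2 hp.out).ne'] at this
    have h2 := ((Asymptotics.isLittleO_one_iff ℝ).2 h1).mul_isBigO
      (Asymptotics.isBigO_refl (fun u : W01p Ω p => ‖u‖) (𝓝 0))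
    simp only [one_mul] at h2
    refine (h2.congr_left fun u => ?_).of_norm_right
    have := abs_rpow_sub_one_mul h0.ne' ‖u‖
    rwa [abs_norm] at this
  rw [IsWeakSolution, hasFDerivAt_iff_isLittleO]
  simpa [hzero] using hO.trans_isLittleO ho

/-- A weak solution satisfies the equation tested with itself. -/
theorem IsWeakSolution.nehari_identity (hpN : p < N) (hΩb : Bornology.IsBounded Ω)
    (hMc : ContinuousOn M (Ici 0)) (hf : IsCaratheodory Ω f) (hK : 0 < K)
    (hg : ∀ᵐ x ∂(volume.restrict Ω), ∀ t,
      |f x t| ≤ K * (|t| ^ (p - 1) + |t| ^ (critExp N p - 1)))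
    {u : W01p Ω p} (hu : u ≠ 0) (hsol : IsWeakSolution M f lam u) :
    M (gradNorm u ^ p) * gradNorm u ^ p - critInt u
      - lam * ∫ x in Ω, f x (fn u x) * fn u x = 0 := by
  have h0 : 0 < p := one_pos.trans hp.out
  have hpq := lt_critExp (N := N) hpN
  have hq : 0 < critExp N p := h0.trans hpq
  obtain ⟨C, hC, H⟩ := exists_integral_growth_le (p := p) (Ω := Ω) hpN hΩb hK
  have hG : 0 < gradNorm u ^ p := Real.rpow_pos_of_pos (gradNorm_pos hpN hΩb hu) p
  -- Only the derivative along the ray is computed, so differentiability of the energy elsewhere is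
  -- not needed; uniqueness of derivatives concludes.
  have hray : HasDerivAt (fun t : ℝ => energy M f lam (t • u)) 0 1 := by
    have h1 : HasDerivAt (fun t : ℝ => t • u) u 1 := by
      simpa using (hasDerivAt_id (1 : ℝ)).smul_const u
    have h2 : HasFDerivAt (energy M f lam) (0 : W01p Ω p →L[ℝ] ℝ) ((1 : ℝ) • u) := by
      rw [one_smul]; exact hsol
    exact h2.comp_hasDerivAt 1 h1
  have hpow : ∀ a : ℝ, HasDerivAt (fun t : ℝ => t ^ a) a 1 := fun a => by
    simpa using Real.hasDerivAt_rpow_const (x := 1) (p := a) (Or.inl one_ne_zero)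
  have hA : HasDerivAt (fun t : ℝ => primitive M (t ^ p * gradNorm u ^ p))
      (M (gradNorm u ^ p) * (p * gradNorm u ^ p)) 1 := by
    refine HasDerivAt.comp (1 : ℝ) (h₂ := primitive M) ?_ ((hpow p).mul_const _)
    rw [Real.one_rpow, one_mul]
    exact hasDerivAt_primitive_of_continuousOn hMc hG
  have hF := hasDerivAt_integral_primitive_mul hf.1 hf.2 hK.le hp.out (hp.out.trans hpq) hg
    (aestronglyMeasurable_fn u) (H u).1 (H u).2.1
  have hE := ((hA.const_mul (1 / p)).sub
    (((hpow (critExp N p)).mul_const (critInt u)).const_mul (1 / critExp N p))).sub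
    (hF.const_mul lam)
  -- Restricting to `t > 0` removes the absolute value from the homogeneity formulas.
  have hEq : (fun t : ℝ => energy M f lam (t • u)) =ᶠ[𝓝 1] fun t =>
      1 / p * primitive M (t ^ p * gradNorm u ^ p)
        - 1 / critExp N p * (t ^ critExp N p * critInt u)
        - lam * ∫ x in Ω, primitive (f x) (t * fn u x) := by
    filter_upwards [Ioi_mem_nhds one_pos] with t ht
    have ht : 0 < t := ht
    have hint : ∫ x in Ω, primitive (f x) (fn (t • u) x) =
        ∫ x in Ω, primitive (f x) (t * fn u x) := by
      refine integral_congr_ae ?_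
      filter_upwards [fn_smul_ae t u] with x hx
      rw [hx]
    rw [energy, gradNorm_smul, critInt_smul, hint, abs_of_pos ht,
      Real.mul_rpow ht.le (gradNorm_nonneg u)]
  have := (hE.congr_of_eventuallyEq hEq).unique hray
  rw [← this]
  field_simp

end Energy

end Kirchhoff

/-! ### The nonexistence theorem. -/

open Kirchhoff in
theorem theorem1p1 {N : ℕ} {p : ℝ} [Fact (1 < p)] (hpN : p < N)
    (Ω : Set (Kirchhoff.Space N)) (hΩo : IsOpen Ω) (hΩc : IsConnected Ω)
    (hΩb : Bornology.IsBounded Ω)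
    (M : ℝ → ℝ) (hMc : ContinuousOn M (Ici 0)) (hM0 : ∀ t, 0 ≤ t → 0 ≤ M t)
    -- positive limit of `M` at `0`
    (hM1 : ∃ m > 0, Tendsto M (𝓝[>] 0) (𝓝 m))
    -- `inf_{t > 0} M(t) / t^{p⋆/p - 1} > S`
    (hM2 : Kirchhoff.sobolevConst Ω p <
      ⨅ t : Ioi (0 : ℝ), M t / (t : ℝ) ^ (Kirchhoff.critExp N p / p - 1))
    (f : Kirchhoff.Space N → ℝ → ℝ) (hf : Kirchhoff.IsCaratheodory Ω f)
    -- subcritical growth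
    (hf1 : ∃ c₁ > 0, ∃ c₂ > 0, ∃ q, p < q ∧ q < Kirchhoff.critExp N p ∧
      ∀ᵐ x ∂(volume.restrict Ω), ∀ t, |f x t| ≤ c₁ + c₂ * |t| ^ (q - 1))
    -- `f(x,t) / |t|^{p-1} → 0` as `t → 0`, uniformly in `x`
    (hf2 : ∀ ε > 0, ∃ δ > 0, ∀ᵐ x ∂(volume.restrict Ω), ∀ t, 0 < |t| → |t| < δ →
      |f x t / |t| ^ (p - 1)| ≤ ε)
    -- sign of `f`
    (hf3 : ∀ᵐ x ∂(volume.restrict Ω), (∀ t, 0 < t → 0 < f x t) ∧ ∀ t, t < 0 → f x t < 0) :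
    ∃ lamStar : ℝ, 0 < lamStar ∧ ∀ lam : ℝ, lam < lamStar →
      ∀ u : Kirchhoff.W01p Ω p, Kirchhoff.IsWeakSolution M f lam u ↔ u = 0 := by
  have hp : 1 < p := Fact.out
  have h0 : 0 < p := one_pos.trans hp
  have hpq := lt_critExp (N := N) hpN
  have hf0 : ∀ᵐ x ∂(volume.restrict Ω), f x 0 = 0 := by
    filter_upwards [hf.2, hf3] with x hx hs using eq_zero_of_sign hx hs.1 hs.2
  obtain ⟨K, hK, hg⟩ := exists_growth_bound hp hf1 hf2 hf0
  obtain ⟨C, hC, H⟩ := exists_integral_growth_le (p := p) (Ω := Ω) hpN hΩb hK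
  obtain ⟨ε, hε, hlow⟩ := exists_lower_bound
    (sub_pos.2 ((one_lt_div h0).2 hpq)) hM0 hM1 hM2
  refine ⟨ε / C, by positivity, fun lam hlam u => ⟨fun hsol => ?_, ?_⟩⟩
  · by_contra hu
    have hG := gradNorm_pos hpN hΩb hu
    have hid := hsol.nehari_identity hpN hΩb hMc hf hK hg hu
    have hJ0 : 0 ≤ ∫ x in Ω, f x (fn u x) * fn u x := by
      refine integral_nonneg_of_ae ?_
      filter_upwards [hf3] with x hs
      rcases lt_trichotomy (fn u x) 0 with h | h | h
      · exact (mul_pos_of_neg_of_neg (hs.2 _ h) h).le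
      · simp [h]
      · exact (mul_pos (hs.1 _ h) h).le
    have hJ1 : ∫ x in Ω, f x (fn u x) * fn u x ≤
        C * (gradNorm u ^ p + gradNorm u ^ critExp N p) := by
      refine (Real.le_norm_self _).trans ((norm_integral_le_of_norm_le
        (((H u).1.add (H u).2.1).const_mul K) ?_).trans (H u).2.2)
      filter_upwards [hg] with x hx
      rw [norm_mul, Real.norm_eq_abs, Real.norm_eq_abs]
      refine (mul_le_mul_of_nonneg_right (hx (fn u x)) (abs_nonneg _)).trans_eq ?_
      rw [mul_assoc, add_mul, abs_rpow_sub_one_mul h0.ne',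
        abs_rpow_sub_one_mul (h0.trans hpq).ne']
      rfl
    -- The exponent in (γ₁) is the one that turns `M(‖u‖^p) ‖u‖^p` into a quantity comparable with
    -- `‖u‖^{p⋆}`.
    have hpow : (gradNorm u ^ p) ^ (critExp N p / p - 1) * gradNorm u ^ p =
        gradNorm u ^ critExp N p := by
      rw [← Real.rpow_mul hG.le, ← Real.rpow_add hG]
      congr 1
      field_simp
      ring
    have h1 := mul_le_mul_of_nonneg_right (hlow (gradNorm u ^ p) (by positivity))
      (Real.rpow_nonneg hG.le p)
    rw [sub_mul, mul_assoc _ _ (gradNorm u ^ p), mul_assoc _ _ (gradNorm u ^ p), add_mul, one_mul,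
      hpow] at h1
    have h2 := critInt_le hpN hΩb u
    have h3 : ε * (gradNorm u ^ p + gradNorm u ^ critExp N p) ≤
        lam * ∫ x in Ω, f x (fn u x) * fn u x := by linarith
    have hX : 0 < gradNorm u ^ p + gradNorm u ^ critExp N p := by positivity
    -- For `lam ≤ 0` the sign of `f` alone contradicts `h3`; for `lam > 0` the upper bound `hJ1` and
    -- `lam * C < ε` do.
    rcases le_or_gt lam 0 with hl | hl
    · have := mul_nonpos_of_nonpos_of_nonneg hl hJ0
      have := mul_pos hε hX
      linarith
    · have h4 := mul_le_mul_of_nonneg_left hJ1 hl.le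
      rw [lt_div_iff₀ hC] at hlam
      have := mul_lt_mul_of_pos_right hlam hX
      linarith
  · rintro rfl
    exact isWeakSolution_zero hpN hΩb hMc hK hg
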